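/- Let $X$ be a compact metric space and $T\colon X\to X$ a continuous map, not necessarily invertible. Let $\mathcal M_T(X)$ be the set of $T$-invariant Borel probability measures on $X$ with the weak-star topology. For $\mu\in\mathcal M_T(X)$, "measurable" refers to the $\mu$-completion of the Borel $\sigma$-algebra. A *$k$-tower partition* for $\mu$ is given by measurable sets $B_1,\dots,B_k$ and integers $n_1,\dots,n_k\ge 1$ such that the sets $T^iB_l$ ($1\le l\le k$, $0\le i<n_l$) are measurable, satisfy $T^iB_l\cap T^{i'}B_{l'}=\emptyset$ for $(l,i)\neq(l',i')$, and $\mu(T^iB_l)=\mu(B_l)$ (this last condition is automatic if $T$ is invertible); it consists of the sets $T^iB_l$ together with the remainder $R=X\setminus\bigcup_{l,i}T^iB_l$. We write $\mathrm{rank}(\mu)\le k$ if for every finite measurable partition $\mathcal Q$ of $X$ and every $\varepsilon>0$ there are a $k$-tower partition $\mathcal P$ with $\mu(R)<\varepsilon$ and a measurable set $Y$ with $\mu(Y)\ge 1-\varepsilon$ such that for every $P\in\mathcal P$ there is $Q\in\mathcal Q$ with $P\cap Y\subset Q\cap Y$. Let $\mathrm{rank}(\mu)\in\{1,2,\dots\}\cup\{\infty\}$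 be the least $k$ with $\mathrm{rank}(\mu)\le k$, and $\infty$ if there is none. **Theorem.** The rank function $\mathrm{rank}\colon\mathcal M_T(X)\to\mathbb N\cup\{\infty\}$ is of Young class LU: there are functions $f_1\le f_2\le\cdots$ from $\mathcal M_T(X)$ to $[-\infty,\infty]$, each upper semicontinuous (that is, $\{\mu: f_n(\mu)<t\}$ is open for every $t\in\mathbb R$), with $\lim_n f_n(\mu)=\mathrm{rank}(\mu)$ for every $\mu\in\mathcal M_T(X)$. -/

import Mathlib

open MeasureTheory Filter Topology

namespace SystemRank

/-- The set `M_T(X)` of `T`-invariant Borel probability measures on `X`. As a subtype of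
`ProbabilityMeasure X` it carries the topology of weak (weak-star) convergence. -/
abbrev InvariantMeasure {X : Type*} [MeasurableSpace X] (T : X → X) : Type _ :=
  {μ : ProbabilityMeasure X // MeasurePreserving T (μ : Measure X) (μ : Measure X)}

/-- A finite partition `Q` of `X` into sets which are measurable for the completion of `μ`
(empty pieces are allowed). -/
structure IsFinitePartition {X : Type*} [MeasurableSpace X] (μ : Measure X) {m : ℕ}
    (Q : Fin m → Set X) : Prop where
  measurable : ∀ j, NullMeasurableSet (Q j) μ
  disjoint : ∀ j j', j ≠ j' → Disjoint (Q j) (Q j')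
  cover : ⋃ j, Q j = Set.univ

/-- `P ≻_ε Q`: there is a measurable set `Y` of measure at least `1 - ε` such that the trace of `P`
on `Y` refines the trace of `Q` on `Y`. -/
def EpsRefines {X : Type*} [MeasurableSpace X] (μ : Measure X) (ε : ℝ) {ι κ : Type*}
    (P : ι → Set X) (Q : κ → Set X) : Prop :=
  ∃ Y : Set X, NullMeasurableSet Y μ ∧ 1 - ε ≤ μ.real Y ∧ ∀ i, ∃ j, P i ∩ Y ⊆ Q j ∩ Y

/-- `k` disjoint measurable towers `B_l, T B_l, …, T^(n_l - 1) B_l`, `l < k`, in the system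
`(X, μ, T)`; measurability refers to the completion of `μ`.

The field `measure_level` says that all levels of a tower have the measure of its base. If `T` is
invertible and preserves `μ` this is automatic. If `T` is not invertible, the image of a null set
may have positive measure, and the condition keeps null sets from contributing to a tower, so that
everything below only depends on the system modulo null sets. -/
structure Towers {X : Type*} [MeasurableSpace X] (T : X → X) (μ : Measure X) (k : ℕ) where
  base : Fin k → Set X
  height : Fin k → ℕ
  height_pos : ∀ l, 0 < height l
  measurable_level : ∀ l, ∀ i < height l, NullMeasurableSet (T^[i] '' base l) μ
  disjoint_level : ∀ l, ∀ i < height l, ∀ l', ∀ i' < height l', (l, i) ≠ (l', i') →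
    Disjoint (T^[i] '' base l) (T^[i'] '' base l')
  measure_level : ∀ l, ∀ i < height l, μ (T^[i] '' base l) = μ (base l)

namespace Towers

variable {X : Type*} [MeasurableSpace X] {T : X → X} {μ : Measure X} {k : ℕ}

/-- The index set of all levels. -/
abbrev Index (𝒯 : Towers T μ k) : Type := Σ l : Fin k, Fin (𝒯.height l)

/-- The level set `T^i B_l`. -/
def level (𝒯 : Towers T μ k) (p : 𝒯.Index) : Set X := T^[p.2] '' 𝒯.base p.1

/-- The remainder: the complement of the union of all level sets. -/
def remainder (𝒯 : Towers T μ k) : Set X := (⋃ p, 𝒯.level p)ᶜ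

/-- The `k`-tower partition: all level sets (`some p`) together with the remainder (`none`). -/
def cell (𝒯 : Towers T μ k) : Option 𝒯.Index → Set X
  | some p => 𝒯.level p
  | none => 𝒯.remainder

end Towers

/-- `rank(μ) ≤ k`: for every finite partition `Q` and `ε > 0` there is a `k`-tower partition `P`
with `P ≻_ε Q` whose remainder has measure less than `ε`. -/
def RankLE {X : Type*} [MeasurableSpace X] (T : X → X) (μ : Measure X) (k : ℕ) : Prop :=
  ∀ (m : ℕ) (Q : Fin m → Set X), IsFinitePartition μ Q → ∀ ε : ℝ, 0 < ε →
    ∃ 𝒯 : Towers T μ k, EpsRefines μ ε 𝒯.cell Q ∧ μ.real 𝒯.remainder < ε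

/-- The rank of `(X, μ, T)`: the least `k` with `rank(μ) ≤ k`, and `∞` if there is none. (For a
probability measure `RankLE T μ 0` fails, as the remainder is then all of `X`.) -/
noncomputable def rank {X : Type*} [MeasurableSpace X] (T : X → X) (μ : Measure X) : ℕ∞ :=
  ⨅ (k : ℕ) (_ : RankLE T μ k), (k : ℕ∞)

/-- Young class LU: pointwise limits of nondecreasing sequences of upper semicontinuous functions
with values in `[-∞, ∞]`. -/
def IsYoungLU {Y : Type*} [TopologicalSpace Y] (f : Y → EReal) : Prop :=
  ∃ F : ℕ → Y → EReal, Monotone F ∧ (∀ n, UpperSemicontinuous (F n)) ∧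
    ∀ y, Tendsto (fun n => F n y) atTop (𝓝 (f y))

end SystemRank

/-! A function to `ℕ∞` is of class LU once its sublevel sets are Gδ, so it suffices that `RankLE T μ
k` is a Gδ condition on `μ`. It is equivalent to `OpenTowerCover T k (1 / (N + 1)) μ` for all `N`,
and each of these is an open condition: the tower data do not involve `μ`, and the exceptional set
is closed, so the portmanteau theorem applies. The equivalence rests on describing towers by
preimages of their tops instead of images of their bases. Since all levels have equal measure and
`T` preserves `μ`, the two descriptions agree up to null sets, but preimages of open sets stay open.
`RankLE.openTowerCover` shrinks the tops to compact sets and then enlarges these to open ones;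
`RankLE.of_openTowerCover` recovers an arbitrary partition from small balls by inner regularity. -/

namespace SystemRank

/-! ### Gδ sublevel sets and class LU. -/

section YoungClass

/-- A function to `ℕ∞` all of whose sublevel sets are `Gδ` is of Young class LU. -/
theorem isYoungLU_of_isGδ_sublevel {Y : Type*} [TopologicalSpace Y] (f : Y → ℕ∞)
    (hf : ∀ k : ℕ, IsGδ {y | f y ≤ k}) : IsYoungLU (fun y => ((f y : ENNReal) : EReal)) := by
  choose g hgo hg using fun k => (hf k).eq_iInter_nat
  set U : ℕ → ℕ → Set Y := fun k n => ⋂ i ∈ Finset.range n, g k i with hU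
  have hUo : ∀ k n, IsOpen (U k n) := fun k n => isOpen_biInter_finset fun i _ => hgo k i
  have hUanti : ∀ k n n', n ≤ n' → U k n' ⊆ U k n := by
    intro k n n' h y hy
    simp only [hU, Set.mem_iInter, Finset.mem_range] at hy ⊢
    exact fun i hi => hy i (hi.trans_le h)
  have hfU : ∀ (k : ℕ) y, f y ≤ k ↔ ∀ n, y ∈ U k n := by
    intro k y
    have : f y ≤ k ↔ ∀ n, y ∈ g k n := by
      rw [← Set.mem_iInter, ← hg k]; rfl
    rw [this]
    simp only [hU, Set.mem_iInter, Finset.mem_range]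
    exact ⟨fun h n i _ => h i, fun h n => h (n + 1) n n.lt_succ_self⟩
  classical
  -- Leaving `U k n` certifies `f y > k`, hence the lower bound `k + 1`.
  set G : ℕ → ℕ → Y → ENNReal := fun n k y => if y ∈ U k n then 0 else ((k + 1 : ℕ) : ENNReal)
    with hG
  have hGle : ∀ n k y, G n k y ≤ f y := by
    intro n k y
    simp only [hG]
    split_ifs with h
    · exact zero_le
    · have h1 : ¬ f y ≤ k := fun h' => h ((hfU k y).1 h' n)
      have h2 : ((k + 1 : ℕ) : ℕ∞) ≤ f y := by
        push_cast
        exact Order.add_one_le_of_lt (not_le.1 h1)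
      exact_mod_cast ENat.toENNReal_le.2 h2
  set F : ℕ → Y → ENNReal := fun n y => (Finset.range n).sup (fun k => G n k y) with hF
  have hFmono : Monotone F := by
    intro n n' h y
    refine Finset.sup_le fun k hk => ?_
    have h1 : G n k y ≤ G n' k y := by
      simp only [hG]
      split_ifs with h1 h2 h2
      · exact le_rfl
      · exact zero_le
      · exact absurd (hUanti k n n' h h2) h1
      · exact le_rfl
    exact h1.trans (Finset.le_sup (f := fun k => G n' k y)
      (Finset.range_mono h hk))
  have hFle : ∀ n y, F n y ≤ f y := fun n y => Finset.sup_le fun k _ => hGle n k y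
  have hsup : ∀ y, ⨆ n, F n y = f y := by
    intro y
    refine le_antisymm (iSup_le fun n => hFle n y) ?_
    have key : ∀ k : ℕ, (k : ℕ∞) < f y → ((k + 1 : ℕ) : ENNReal) ≤ ⨆ n, F n y := by
      intro k hk
      obtain ⟨n, hn⟩ := not_forall.1 (mt (hfU k y).2 (not_le.2 hk))
      set n' := max n (k + 1)
      have hn' : y ∉ U k n' := fun h => hn (hUanti k n n' (le_max_left _ _) h)
      calc ((k + 1 : ℕ) : ENNReal) = G n' k y := by simp only [hG, if_neg hn']
        _ ≤ F n' y := Finset.le_sup (f := fun k => G n' k y)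
            (Finset.mem_range.2 ((Nat.lt_succ_self k).trans_le (le_max_right _ _)))
        _ ≤ ⨆ n, F n y := le_iSup (fun n => F n y) n'
    induction h : f y using ENat.recTopCoe with
    | top =>
      rw [ENat.toENNReal_top, top_le_iff]
      refine ENNReal.eq_top_of_forall_nnreal_le fun r => ?_
      obtain ⟨k, hk⟩ := exists_nat_gt r
      refine le_trans ?_ (key k (by rw [h]; exact ENat.natCast_lt_top k))
      have : (r : ENNReal) < (k : ENNReal) := by exact_mod_cast hk
      exact this.le.trans (by exact_mod_cast Nat.le_succ k)
    | coe m =>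
      cases m with
      | zero => simp
      | succ k =>
        have := key k (by rw [h]; exact_mod_cast Nat.lt_succ_self k)
        simpa using this
  refine ⟨fun n y => (F n y : EReal), fun n n' h y => ?_, fun n y c hc => ?_, fun y => ?_⟩
  · exact EReal.coe_ennreal_le_coe_ennreal_iff.2 (hFmono h y)
  · have h0 : (0 : EReal) < c := lt_of_le_of_lt (EReal.coe_ennreal_nonneg _) hc
    -- On the open set `U k n` the value stays 0; off it, `G n k` is already at its maximum `k + 1`.
    have hev : ∀ᶠ y' in 𝓝 y, ∀ k ∈ Finset.range n, G n k y' ≤ G n k y := by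
      rw [eventually_all_finset]
      intro k _
      by_cases h : y ∈ U k n
      · filter_upwards [(hUo k n).mem_nhds h] with y' hy'
        simp [hG, h, hy']
      · refine Eventually.of_forall fun y' => ?_
        simp only [hG, if_neg h]
        split_ifs
        · exact zero_le
        · exact le_rfl
    filter_upwards [hev] with y' hy'
    refine lt_of_le_of_lt (EReal.coe_ennreal_le_coe_ennreal_iff.2 ?_) hc
    exact Finset.sup_mono_fun hy'
  · have h := tendsto_atTop_iSup (f := fun n => F n y) fun n n' h => hFmono h y
    rw [hsup] at h
    exact (continuous_coe_ennreal_ereal.tendsto _).comp h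

end YoungClass

section Rank

variable {X : Type*} [MeasurableSpace X]

/-- Keeping `j ≤ k` avoids monotonicity of `RankLE` in `k`; a finite union of Gδ sets is still Gδ.
-/
theorem rank_le_coe_iff (T : X → X) (μ : Measure X) (k : ℕ) :
    rank T μ ≤ k ↔ ∃ j ≤ k, RankLE T μ j := by
  constructor
  · intro h
    by_contra! hcon
    have h1 : ((k + 1 : ℕ) : ℕ∞) ≤ rank T μ := by
      refine le_iInf₂ fun j hj => ?_
      have : ¬ j ≤ k := fun h' => hcon j h' hj
      exact_mod_cast (by omega : k + 1 ≤ j)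
    have h2 : k + 1 ≤ k := by exact_mod_cast h1.trans h
    omega
  · rintro ⟨j, hjk, hj⟩
    exact (iInf₂_le j hj).trans (by exact_mod_cast hjk)

end Rank

/-! ### Compact approximation and fine partitions. -/

section Approximation

variable {X : Type*}

/-- Finitely many pairwise disjoint compact sets have positive mutual distance. -/
theorem exists_pos_le_dist_of_isCompact {ι : Type*} [Finite ι] [MetricSpace X] {K : ι → Set X}
    (hK : ∀ i, IsCompact (K i)) (hd : Pairwise (Function.onFun Disjoint K)) :
    ∃ δ : ℝ, 0 < δ ∧ ∀ i j, i ≠ j → ∀ x ∈ K i, ∀ y ∈ K j, δ ≤ dist x y := by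
  have key : ∀ p : ι × ι, ∃ δ : ℝ, 0 < δ ∧
      (p.1 ≠ p.2 → ∀ x ∈ K p.1, ∀ y ∈ K p.2, δ ≤ dist x y) := by
    rintro ⟨i, j⟩
    by_cases h : i = j
    · exact ⟨1, one_pos, fun h' => absurd h h'⟩
    · obtain ⟨r, hr, hrd⟩ := Metric.exists_pos_forall_lt_edist (hK i) (hK j).isClosed (hd h)
      refine ⟨r, hr, fun _ x hx y hy => ?_⟩
      have := hrd x hx y hy
      rw [edist_nndist] at this
      exact_mod_cast this.le
  choose δ hδ hδd using key
  obtain ⟨δ₀, h₀, h₁⟩ : ∃ δ₀ : ℝ, 0 < δ₀ ∧ ∀ p, δ₀ ≤ δ p := by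
    cases isEmpty_or_nonempty (ι × ι)
    · exact ⟨1, one_pos, fun p => isEmptyElim p⟩
    · obtain ⟨p, hp⟩ := Finite.exists_min δ
      exact ⟨δ p, hδ p, hp⟩
  exact ⟨δ₀, h₀, fun i j h x hx y hy => (h₁ (i, j)).trans (hδd (i, j) h x hx y hy)⟩

/-- Finitely many pairwise disjoint compact sets have pairwise disjoint open neighbourhoods. -/
theorem exists_disjoint_open_superset {ι : Type*} [Finite ι] [MetricSpace X] {K : ι → Set X}
    (hK : ∀ i, IsCompact (K i)) (hd : Pairwise (Function.onFun Disjoint K)) :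
    ∃ O : ι → Set X, (∀ i, IsOpen (O i)) ∧ (∀ i, K i ⊆ O i) ∧
      Pairwise (Function.onFun Disjoint O) := by
  obtain ⟨δ, hδ, h⟩ := exists_pos_le_dist_of_isCompact hK hd
  refine ⟨fun i => Metric.thickening (δ / 2) (K i), fun i => Metric.isOpen_thickening,
    fun i => Metric.self_subset_thickening (half_pos hδ) _, fun i j hij => ?_⟩
  refine Set.disjoint_left.2 fun z hz hz' => ?_
  obtain ⟨x, hx, hzx⟩ := Metric.mem_thickening_iff.1 hz
  obtain ⟨y, hy, hzy⟩ := Metric.mem_thickening_iff.1 hz'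
  have h1 := h i j hij x hx y hy
  have h2 := dist_triangle_left x y z
  linarith

theorem exists_isCompact_subset_of_nullMeasurableSet [MetricSpace X] [CompactSpace X]
    [MeasurableSpace X] [BorelSpace X] {μ : Measure X} [IsFiniteMeasure μ] {S : Set X}
    (hS : NullMeasurableSet S μ) {ε : ENNReal} (hε : ε ≠ 0) :
    ∃ K ⊆ S, IsCompact K ∧ μ (S \ K) < ε := by
  obtain ⟨S', hS'S, hS', hae⟩ := hS.exists_measurable_subset_ae_eq
  obtain ⟨K, hKS, hK, hlt⟩ := hS'.exists_isCompact_sdiff_lt (μ := μ) (measure_ne_top _ _) hε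
  refine ⟨K, hKS.trans hS'S, hK, ?_⟩
  rwa [measure_congr (hae.symm.diff (ae_eq_refl K))]

/-- In a compact metric space there are finite partitions into Borel subsets of small balls. -/
theorem exists_isFinitePartition_subset_ball [MetricSpace X] [CompactSpace X]
    [MeasurableSpace X] [BorelSpace X] (μ : Measure X) {ε : ℝ} (hε : 0 < ε) :
    ∃ (m : ℕ) (Q : Fin m → Set X) (c : Fin m → X), IsFinitePartition μ Q ∧
      ∀ j, Q j ⊆ Metric.ball (c j) ε := by
  obtain ⟨t, -, htf, htc⟩ := Metric.finite_approx_of_totallyBounded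
    (isCompact_univ (X := X)).totallyBounded ε hε
  obtain ⟨m, c, hc⟩ : ∃ (m : ℕ) (c : Fin m → X), Set.range c = t := by
    obtain ⟨m, c, -, hc⟩ := htf.fin_param
    exact ⟨m, c, hc⟩
  have hcov : ∀ x, ∃ j, x ∈ Metric.ball (c j) ε := by
    intro x
    have := htc (Set.mem_univ x)
    simp only [Set.mem_iUnion, ← hc] at this
    obtain ⟨_, ⟨j, rfl⟩, h⟩ := this
    exact ⟨j, h⟩
  refine ⟨m, disjointed fun j => Metric.ball (c j) ε, c, ⟨fun j => ?_, ?_, ?_⟩,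
    fun j => disjointed_subset _ j⟩
  · rw [disjointed_apply, Finset.sup_set_eq_biUnion]
    exact (Metric.isOpen_ball.measurableSet.diff (Finset.measurableSet_biUnion _
      fun i _ => Metric.isOpen_ball.measurableSet)).nullMeasurableSet
  · exact fun j j' h => disjoint_disjointed _ h
  · rw [iUnion_disjointed]
    exact Set.eq_univ_of_forall fun x => Set.mem_iUnion.2 (hcov x)

end Approximation

/-! ### Levels as preimages of tops, modulo null sets. -/

section Tops

variable {X : Type*} [MeasurableSpace X] {T : X → X} {μ : Measure X} {k : ℕ}

/-- The top of a tower. -/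
def Towers.top (𝒯 : Towers T μ k) (l : Fin k) : Set X := T^[𝒯.height l - 1] '' 𝒯.base l

theorem Towers.level_subset_preimage_top (𝒯 : Towers T μ k) (l : Fin k) {i : ℕ}
    (hi : i < 𝒯.height l) :
    T^[𝒯.height l - 1 - i] '' 𝒯.base l ⊆ T^[i] ⁻¹' 𝒯.top l := by
  rintro _ ⟨y, hy, rfl⟩
  refine ⟨y, hy, ?_⟩
  rw [← Function.iterate_add_apply]
  congr 2
  omega

theorem Towers.nullMeasurableSet_top (𝒯 : Towers T μ k) (l : Fin k) :
    NullMeasurableSet (𝒯.top l) μ :=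
  𝒯.measurable_level l _ (Nat.sub_lt (𝒯.height_pos l) one_pos)

/-- The level is contained in the preimage, and by invariance and `measure_level` both have the
finite measure of the base. -/
theorem Towers.measure_preimage_top_diff [IsFiniteMeasure μ] (hμ : MeasurePreserving T μ μ)
    (𝒯 : Towers T μ k) (l : Fin k) {i : ℕ} (hi : i < 𝒯.height l) :
    μ (T^[i] ⁻¹' 𝒯.top l \ T^[𝒯.height l - 1 - i] '' 𝒯.base l) = 0 := by
  have hp := 𝒯.height_pos l
  rw [measure_sdiff (𝒯.level_subset_preimage_top l hi)
    (𝒯.measurable_level l _ (by omega)) (measure_ne_top _ _),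
    (hμ.iterate i).measure_preimage (𝒯.nullMeasurableSet_top l),
    𝒯.measure_level l _ (by omega), Towers.top, 𝒯.measure_level l _ (by omega), tsub_self]

/-- Almost every point of `T^[d] ⁻¹' 𝒯.top l'` lies in a level strictly below the top of tower `l'`,
which is disjoint from every top. -/
theorem Towers.measure_top_inter_preimage_top [IsFiniteMeasure μ] (hμ : MeasurePreserving T μ μ)
    (𝒯 : Towers T μ k) (l l' : Fin k) {d : ℕ} (hd : 0 < d) (hd' : d < 𝒯.height l') :
    μ (𝒯.top l ∩ T^[d] ⁻¹' 𝒯.top l') = 0 := by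
  refine measure_mono_null ?_ (𝒯.measure_preimage_top_diff hμ l' hd')
  rintro y ⟨hy, hy'⟩
  refine ⟨hy', fun h => ?_⟩
  have hp := 𝒯.height_pos l
  refine Set.disjoint_left.1 (𝒯.disjoint_level l (𝒯.height l - 1) (by omega) l'
    (𝒯.height l' - 1 - d) (by omega) fun he => ?_) hy h
  obtain ⟨rfl, he⟩ := Prod.mk_inj.1 he
  omega

end Tops

/-! ### Open towers and their equivalence with rank. -/

section OpenTowers

variable {X : Type*}

/-- There are `k` disjoint towers with open levels, given by the preimages of their open tops
`V l`, such that all points outside a set of measure less than `ε` lie in a level and in a ball of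
radius `ε` attached to this level. -/
def OpenTowerCover [MetricSpace X] [MeasurableSpace X] (T : X → X) (k : ℕ) (ε : ℝ)
    (μ : Measure X) : Prop :=
  ∃ (n : Fin k → ℕ) (V : Fin k → Set X) (x : (Σ l, Fin (n l)) → X),
    (∀ l, 0 < n l) ∧ (∀ l, IsOpen (V l)) ∧
    Pairwise (Function.onFun Disjoint fun p : Σ l, Fin (n l) => T^[p.2] ⁻¹' V p.1) ∧
    μ (⋃ p : Σ l, Fin (n l), T^[p.2] ⁻¹' V p.1 ∩ Metric.ball (x p) ε)ᶜ < ENNReal.ofReal ε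

theorem isOpen_setOf_openTowerCover [MetricSpace X] [MeasurableSpace X] [BorelSpace X] {T : X → X}
    (hT : Continuous T) (k : ℕ) (ε : ℝ) :
    IsOpen {μ : ProbabilityMeasure X | OpenTowerCover T k ε (μ : Measure X)} := by
  rw [isOpen_iff_mem_nhds]
  rintro μ ⟨n, V, x, hn, hV, hd, hμ⟩
  have hcl : IsClosed (⋃ p : Σ l, Fin (n l), T^[p.2] ⁻¹' V p.1 ∩ Metric.ball (x p) ε)ᶜ :=
    (isOpen_iUnion fun p : Σ l, Fin (n l) =>
      ((hV p.1).preimage (hT.iterate p.2)).inter Metric.isOpen_ball).isClosed_compl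
  have hlim := ProbabilityMeasure.limsup_measure_closed_le_of_tendsto
    (tendsto_id (x := 𝓝 μ)) hcl
  filter_upwards [eventually_lt_of_limsup_lt (hlim.trans_lt hμ)] with ν hν
  exact ⟨n, V, x, hn, hV, hd, hν⟩

theorem image_iterate_preimage_iterate (T : X → X) (V : Set X) {i n : ℕ} (h : i < n) :
    T^[i] '' (T^[n - 1] ⁻¹' V) = T^[n - 1 - i] ⁻¹' V ∩ Set.range T^[i] := by
  have : T^[n - 1] = T^[n - 1 - i] ∘ T^[i] := by
    rw [← Function.iterate_add]; congr 1; omega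
  rw [this, Set.preimage_comp, Set.image_preimage_eq_inter_range]

/-- The preimage of this set under `T^[i]` is empty. -/
theorem measure_compl_range_iterate [TopologicalSpace X] [CompactSpace X] [T2Space X]
    [MeasurableSpace X] [BorelSpace X] {T : X → X} (hT : Continuous T) {μ : Measure X}
    (hμ : MeasurePreserving T μ μ) (i : ℕ) : μ (Set.range T^[i])ᶜ = 0 := by
  have hm : MeasurableSet (Set.range T^[i]) :=
    (isCompact_range (hT.iterate i)).isClosed.measurableSet
  rw [← (hμ.iterate i).measure_preimage hm.compl.nullMeasurableSet]
  simp

variable [MetricSpace X] [CompactSpace X] [MeasurableSpace X] [BorelSpace X] {T : X → X}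
  {μ : Measure X} {k : ℕ}

/-- The towers whose tops are given by measurable sets with disjoint preimages. -/
def towersOfTops (hT : Continuous T) (hμ : MeasurePreserving T μ μ) (n : Fin k → ℕ)
    (V : Fin k → Set X) (hn : ∀ l, 0 < n l) (hV : ∀ l, MeasurableSet (V l))
    (hd : Pairwise (Function.onFun Disjoint fun p : Σ l, Fin (n l) => T^[p.2] ⁻¹' V p.1)) :
    Towers T μ k where
  base l := T^[n l - 1] ⁻¹' V l
  height := n
  height_pos := hn
  measurable_level l i hi := by
    rw [image_iterate_preimage_iterate T (V l) hi]
    exact ((hT.iterate _).measurable (hV l)).inter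
      (isCompact_range (hT.iterate i)).isClosed.measurableSet |>.nullMeasurableSet
  disjoint_level l i hi l' i' hi' hne := by
    rw [image_iterate_preimage_iterate T (V l) hi, image_iterate_preimage_iterate T (V l') hi']
    refine Disjoint.mono Set.inter_subset_left Set.inter_subset_left ?_
    refine @hd ⟨l, n l - 1 - i, by omega⟩ ⟨l', n l' - 1 - i', by omega⟩ fun h => hne ?_
    obtain ⟨rfl, h⟩ := Sigma.mk.inj_iff.1 h
    have := Fin.mk.inj_iff.1 (eq_of_heq h)
    exact Prod.ext rfl (by simp only; omega)
  measure_level l i hi := by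
    have h0 := measure_compl_range_iterate hT hμ i
    rw [image_iterate_preimage_iterate T (V l) hi, measure_inter_conull h0,
      (hμ.iterate _).measure_preimage (hV l).nullMeasurableSet,
      (hμ.iterate _).measure_preimage (hV l).nullMeasurableSet]

/-- Compact `K j ⊆ Q j` of almost full measure are `δ`-separated, so a ball of radius below `δ / 2`
meets at most one of them. -/
theorem RankLE.of_openTowerCover [IsProbabilityMeasure μ] (hT : Continuous T)
    (hμ : MeasurePreserving T μ μ) (h : ∀ N : ℕ, OpenTowerCover T k (1 / (N + 1)) μ) :
    RankLE T μ k := by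
  intro m Q hQ ε hε
  -- An index is needed even for cells that miss `Y`, such as the remainder.
  have hm : 0 < m := by
    rcases Nat.eq_zero_or_pos m with rfl | h
    · have h1 := hQ.cover
      have h2 : μ Set.univ = 1 := measure_univ
      rw [← h1] at h2
      simp at h2
    · exact h
  obtain ⟨η, hη, hηm⟩ := ENNReal.exists_nnreal_pos_mul_lt (a := (m : ENNReal))
    (b := ENNReal.ofReal (ε / 2)) (by simp) (by simpa using hε)
  choose K hKQ hK hKμ using fun j => exists_isCompact_subset_of_nullMeasurableSet
    (hQ.measurable j) (ε := η) (by exact_mod_cast hη.ne')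
  have hKd : Pairwise (Function.onFun Disjoint K) := fun i j hij =>
    (hQ.disjoint i j hij).mono (hKQ i) (hKQ j)
  obtain ⟨δ, hδ, hdist⟩ := exists_pos_le_dist_of_isCompact hK hKd
  obtain ⟨N, hN⟩ := exists_nat_one_div_lt (lt_min (half_pos hδ) (half_pos hε))
  obtain ⟨n, V, x, hn, hV, hd, hlt⟩ := h N
  set r : ℝ := 1 / ((N : ℝ) + 1)
  set 𝒯 := towersOfTops hT hμ n V hn (fun l => (hV l).measurableSet) hd with h𝒯
  set O := ⋃ p : Σ l, Fin (n l), T^[p.2] ⁻¹' V p.1 ∩ Metric.ball (x p) r with hO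
  have hOm : MeasurableSet O := MeasurableSet.iUnion fun p =>
    (((hV p.1).preimage (hT.iterate p.2)).inter Metric.isOpen_ball).measurableSet
  -- On this conull set the image levels of `𝒯` coincide with the preimages of the tops.
  set R := ⋂ p : Σ l, Fin (n l), Set.range T^[n p.1 - 1 - p.2] with hR
  have hRm : MeasurableSet R := MeasurableSet.iInter fun p =>
    (isCompact_range (hT.iterate _)).isClosed.measurableSet
  have hR0 : μ Rᶜ = 0 := by
    rw [hR, Set.compl_iInter]
    exact measure_iUnion_null fun p => measure_compl_range_iterate hT hμ _
  set L := ⋃ j, K j with hL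
  have hLm : MeasurableSet L := MeasurableSet.iUnion fun j => (hK j).isClosed.measurableSet
  have hLμ : μ Lᶜ < ENNReal.ofReal (ε / 2) := by
    have hsub : Lᶜ ⊆ ⋃ j, Q j \ K j := by
      intro y hy
      obtain ⟨j, hj⟩ := Set.mem_iUnion.1 (hQ.cover.symm ▸ Set.mem_univ y : y ∈ ⋃ j, Q j)
      exact Set.mem_iUnion.2 ⟨j, hj, fun h => hy (Set.mem_iUnion.2 ⟨j, h⟩)⟩
    calc μ Lᶜ ≤ ∑ j, μ (Q j \ K j) := (measure_mono hsub).trans (measure_iUnion_fintype_le _ _)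
      _ ≤ ∑ _j : Fin m, (η : ENNReal) := Finset.sum_le_sum fun j _ => (hKμ j).le
      _ = η * m := by simp [mul_comm]
      _ < _ := hηm
  have hORμ : μ (O ∩ R)ᶜ < ENNReal.ofReal (ε / 2) := by
    rw [Set.compl_inter]
    calc μ (Oᶜ ∪ Rᶜ) ≤ μ Oᶜ + μ Rᶜ := measure_union_le _ _
      _ = μ Oᶜ := by rw [hR0, add_zero]
      _ < ENNReal.ofReal r := hlt
      _ ≤ _ := ENNReal.ofReal_le_ofReal (hN.le.trans (min_le_right _ _))
  have hcover : O ∩ R ⊆ ⋃ p, 𝒯.level p := by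
    rintro y ⟨hy, hyR⟩
    obtain ⟨⟨l, i⟩, hp, -⟩ := Set.mem_iUnion.1 hy
    have hlt' : n l - 1 - i < n l := by omega
    refine Set.mem_iUnion.2 ⟨⟨l, ⟨n l - 1 - i, hlt'⟩⟩, ?_⟩
    change y ∈ T^[n l - 1 - i] '' (T^[n l - 1] ⁻¹' V l)
    rw [image_iterate_preimage_iterate T (V l) hlt']
    refine ⟨?_, Set.mem_iInter.1 hyR ⟨l, i⟩⟩
    rw [show n l - 1 - (n l - 1 - i) = i by omega]
    exact hp
  refine ⟨𝒯, ⟨O ∩ R ∩ L, ((hOm.inter hRm).inter hLm).nullMeasurableSet, ?_, ?_⟩, ?_⟩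
  · have h1 : μ.real (O ∩ R ∩ L)ᶜ ≤ ε := by
      refine ENNReal.toReal_le_of_le_ofReal hε.le ?_
      rw [Set.compl_inter]
      refine (measure_union_le _ _).trans ((add_le_add hORμ.le hLμ.le).trans ?_)
      rw [← ENNReal.ofReal_add (by linarith) (by linarith), add_halves]
    rw [probReal_compl_eq_one_sub ((hOm.inter hRm).inter hLm)] at h1
    linarith
  · rintro (_ | ⟨l, i, hi⟩)
    · refine ⟨⟨0, hm⟩, fun y hy => absurd (hcover hy.2.1) hy.1⟩
    · change i < n l at hi
      have hsame : ∀ y ∈ 𝒯.cell (some ⟨l, i, hi⟩) ∩ (O ∩ R ∩ L),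
          y ∈ Metric.ball (x ⟨l, n l - 1 - i, by omega⟩) r := by
        rintro y ⟨hy, ⟨hyO, -⟩, -⟩
        change y ∈ T^[i] '' (T^[n l - 1] ⁻¹' V l) at hy
        rw [image_iterate_preimage_iterate T (V l) hi] at hy
        obtain ⟨p, hp, hpb⟩ := Set.mem_iUnion.1 hyO
        have : p = ⟨l, n l - 1 - i, by omega⟩ := by
          by_contra hne
          exact Set.disjoint_left.1 (hd hne) hp hy.1
        rwa [this] at hpb
      rcases Set.eq_empty_or_nonempty (𝒯.cell (some ⟨l, i, hi⟩) ∩ (O ∩ R ∩ L)) with he | ⟨y, hy⟩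
      · exact ⟨⟨0, hm⟩, by rw [he]; exact Set.empty_subset _⟩
      · obtain ⟨j, hj⟩ := Set.mem_iUnion.1 hy.2.2
        refine ⟨j, fun z hz => ⟨?_, hz.2⟩⟩
        obtain ⟨j', hj'⟩ := Set.mem_iUnion.1 hz.2.2
        have hjj : j' = j := by
          by_contra hne
          have h1 := hdist j' j hne z hj' y hj
          have h2 := Metric.mem_ball.1 (hsame z hz)
          have h3 := Metric.mem_ball.1 (hsame y hy)
          have h4 := dist_triangle_right z y (x ⟨l, n l - 1 - i, by omega⟩)
          have h5 := hN.trans_le (min_le_left _ _)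
          linarith
        exact hKQ j (hjj ▸ hj')
  · have h1 : μ 𝒯.remainder < ENNReal.ofReal (ε / 2) :=
      (measure_mono (Set.compl_subset_compl.2 hcover)).trans_lt hORμ
    have h2 := (ENNReal.toReal_lt_of_lt_ofReal h1)
    change μ.real _ < _ at h2
    linarith

/-- The rank condition is applied to a partition into pieces of `ε`-balls. The error splits into
three parts of size `ε / 3`: the complement of `Y`, the remainder, and the loss from passing to
compact tops. -/
theorem RankLE.openTowerCover [IsProbabilityMeasure μ] (hT : Continuous T)
    (hμ : MeasurePreserving T μ μ) (h : RankLE T μ k) {ε : ℝ} (hε : 0 < ε) :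
    OpenTowerCover T k ε μ := by
  obtain ⟨m, Q, c, hQ, hQc⟩ := exists_isFinitePartition_subset_ball μ hε
  obtain ⟨𝒯, ⟨Y, hYm, hY, hYQ⟩, hrem⟩ := h m Q hQ (ε / 3) (by linarith)
  set C := 𝒯.top with hC
  have hCm := 𝒯.nullMeasurableSet_top
  -- Remove null sets to make the preimages of the tops exactly disjoint.
  set Z : Set X := ⋃ l, ⋃ l', ⋃ d : {d : ℕ // 0 < d ∧ d < 𝒯.height l'}, C l ∩ T^[d] ⁻¹' C l' with hZ
  have hZ0 : μ Z = 0 := measure_iUnion_null fun l => measure_iUnion_null fun l' =>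
    measure_iUnion_null fun d => 𝒯.measure_top_inter_preimage_top hμ l l' d.2.1 d.2.2
  have hCZm : ∀ l, NullMeasurableSet (C l \ Z) μ := fun l =>
    (hCm l).diff (NullMeasurableSet.of_null hZ0)
  -- By invariance the loss `C l \ K l` recurs with equal measure in each level, hence the factor
  -- counting all levels.
  obtain ⟨η, hη, hηm⟩ := ENNReal.exists_nnreal_pos_mul_lt
    (a := (Fintype.card 𝒯.Index : ENNReal))
    (b := ENNReal.ofReal (ε / 3)) (by simp) (by simpa using hε)
  choose K hKC hK hKμ using fun l => exists_isCompact_subset_of_nullMeasurableSet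
    (hCZm l) (ε := η) (by exact_mod_cast hη.ne')
  have hnot : ∀ l l' (j j' : ℕ), j < 𝒯.height l → j' < 𝒯.height l' → j ≤ j' →
      ((⟨l, j⟩ : Σ _ : Fin k, ℕ) ≠ ⟨l', j'⟩) → ∀ y, T^[j] y ∈ K l → T^[j'] y ∈ K l' → False := by
    intro l l' j j' hj hj' hle hne y hy hy'
    rcases hle.eq_or_lt with rfl | hlt
    · have hll : l ≠ l' := fun h => hne (by rw [h])
      have hp := 𝒯.height_pos l
      have hp' := 𝒯.height_pos l'
      exact Set.disjoint_left.1 (𝒯.disjoint_level l (𝒯.height l - 1) (by omega) l'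
        (𝒯.height l' - 1) (by omega) fun he => hll (Prod.mk_inj.1 he).1)
        (hKC l hy).1 (hKC l' hy').1
    -- With `d = j' - j`, the point `T^[j] y` would lie in `C l ∩ T^[d] ⁻¹' C l' ⊆ Z`.
    · refine (hKC l hy).2 ?_
      simp only [hZ, Set.mem_iUnion]
      refine ⟨l, l', ⟨j' - j, by omega, by omega⟩, (hKC l hy).1, ?_⟩
      rw [Set.mem_preimage, ← Function.iterate_add_apply, Nat.sub_add_cancel hle]
      exact (hKC l' hy').1
  have hKd : Pairwise (Function.onFun Disjoint fun p : 𝒯.Index => T^[p.2] ⁻¹' K p.1) := by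
    rintro ⟨l, j⟩ ⟨l', j'⟩ hne
    refine Set.disjoint_left.2 fun y hy hy' => ?_
    have hne' : (⟨l, j⟩ : Σ _ : Fin k, ℕ) ≠ ⟨l', j'⟩ := by
      intro he
      obtain ⟨rfl, he⟩ := Sigma.mk.inj_iff.1 he
      exact hne (by rw [Fin.ext (eq_of_heq he)])
    rcases le_total (j : ℕ) j' with hle | hle
    · exact hnot l l' j j' j.2 j'.2 hle hne' y hy hy'
    · exact hnot l' l j' j j'.2 j.2 hle hne'.symm y hy' hy
  obtain ⟨O, hOo, hKO, hOd⟩ := exists_disjoint_open_superset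
    (fun p : 𝒯.Index => ((hK p.1).isClosed.preimage (hT.iterate p.2)).isCompact) hKd
  -- Open neighbourhoods of the compact tops whose preimages stay inside the sets `O p`.
  set V : Fin k → Set X := fun l => ⋂ j : Fin (𝒯.height l), (T^[j] '' (O ⟨l, j⟩)ᶜ)ᶜ with hV
  have hVo : ∀ l, IsOpen (V l) := fun l => isOpen_iInter_of_finite fun j =>
    ((hOo ⟨l, j⟩).isClosed_compl.isCompact.image (hT.iterate j)).isClosed.isOpen_compl
  have hKV : ∀ l, K l ⊆ V l := by
    intro l y hy
    refine Set.mem_iInter.2 fun j => ?_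
    rintro ⟨z, hz, rfl⟩
    exact hz (hKO ⟨l, j⟩ hy)
  have hVO : ∀ p : 𝒯.Index, T^[p.2] ⁻¹' V p.1 ⊆ O p := by
    rintro ⟨l, j⟩ y hy
    by_contra hyO
    exact Set.mem_iInter.1 hy j ⟨y, hyO, rfl⟩
  have hrev : ∀ p : 𝒯.Index, 𝒯.height p.1 - 1 - p.2 < 𝒯.height p.1 := fun p => by
    have := 𝒯.height_pos p.1
    omega
  -- Here `p.2` counts down from the top, whereas `cell` counts up from the base.
  choose q hq using fun p : 𝒯.Index => hYQ (some ⟨p.1, _, hrev p⟩)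
  refine ⟨𝒯.height, V, fun p => c (q p), 𝒯.height_pos, hVo,
    fun p p' hne => (hOd hne).mono (hVO p) (hVO p'), ?_⟩
  have hsub : (⋃ p : 𝒯.Index, T^[p.2] ⁻¹' V p.1 ∩ Metric.ball (c (q p)) ε)ᶜ ⊆
      Yᶜ ∪ 𝒯.remainder ∪ ⋃ p : 𝒯.Index, T^[p.2] ⁻¹' (C p.1 \ K p.1) := by
    intro y hy
    by_contra hcon
    simp only [Set.mem_union, not_or, Set.mem_compl_iff, not_not] at hcon
    obtain ⟨⟨hyY, hyr⟩, hyK⟩ := hcon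
    obtain ⟨⟨l, i⟩, hi⟩ := Set.mem_iUnion.1 (not_not.1 hyr)
    set p : 𝒯.Index := ⟨l, 𝒯.height l - 1 - i, hrev ⟨l, i⟩⟩ with hp
    have hpi : 𝒯.height l - 1 - (𝒯.height l - 1 - i) = i := by omega
    have hlev : y ∈ T^[𝒯.height l - 1 - (𝒯.height l - 1 - i)] '' 𝒯.base l := by
      rw [hpi]; exact hi
    have hyC : T^[p.2] y ∈ C l :=
      𝒯.level_subset_preimage_top l (hrev ⟨l, i⟩) hlev
    have hyKl : T^[p.2] y ∈ K l := by
      by_contra hn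
      exact hyK (Set.mem_iUnion.2 ⟨p, hyC, hn⟩)
    exact hy (Set.mem_iUnion.2 ⟨p, hKV l hyKl, hQc _ (hq p ⟨hlev, hyY⟩).1⟩)
  have hY' : μ Yᶜ ≤ ENNReal.ofReal (ε / 3) := by
    have h1 : μ.real Yᶜ ≤ ε / 3 := by
      rw [measureReal_compl₀ hYm, probReal_univ]
      linarith
    exact (ENNReal.le_ofReal_iff_toReal_le (measure_ne_top _ _) (by linarith)).2 h1
  have hr' : μ 𝒯.remainder ≤ ENNReal.ofReal (ε / 3) :=
    (ENNReal.le_ofReal_iff_toReal_le (measure_ne_top _ _) (by linarith)).2 hrem.le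
  have hCK : ∀ l, μ (C l \ K l) ≤ η := by
    intro l
    have : C l \ K l ⊆ ((C l \ Z) \ K l) ∪ Z := by
      intro y hy
      by_cases hz : y ∈ Z
      · exact Or.inr hz
      · exact Or.inl ⟨⟨hy.1, hz⟩, hy.2⟩
    calc μ (C l \ K l) ≤ μ ((C l \ Z) \ K l) + μ Z := (measure_mono this).trans (measure_union_le _ _)
      _ ≤ η := by rw [hZ0, add_zero]; exact (hKμ l).le
  have hlev : μ (⋃ p : 𝒯.Index, T^[p.2] ⁻¹' (C p.1 \ K p.1)) < ENNReal.ofReal (ε / 3) := by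
    calc _ ≤ ∑ p : 𝒯.Index, μ (T^[p.2] ⁻¹' (C p.1 \ K p.1)) := measure_iUnion_fintype_le _ _
      _ ≤ ∑ _p : 𝒯.Index, (η : ENNReal) := Finset.sum_le_sum fun p _ => by
          rw [(hμ.iterate p.2).measure_preimage
            ((hCm p.1).diff (hK p.1).isClosed.measurableSet.nullMeasurableSet)]
          exact hCK p.1
      _ = η * Fintype.card 𝒯.Index := by
          rw [Finset.sum_const, Finset.card_univ, nsmul_eq_mul, mul_comm]
      _ < _ := hηm
  calc _ ≤ μ Yᶜ + μ 𝒯.remainder + μ (⋃ p : 𝒯.Index, T^[p.2] ⁻¹' (C p.1 \ K p.1)) :=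
        (measure_mono hsub).trans ((measure_union_le _ _).trans
          (add_le_add_left (measure_union_le _ _) _))
    _ < ENNReal.ofReal (ε / 3) + ENNReal.ofReal (ε / 3) + ENNReal.ofReal (ε / 3) :=
        ENNReal.add_lt_add_of_le_of_lt (by finiteness) (add_le_add hY' hr') hlev
    _ = ENNReal.ofReal ε := by
        rw [← ENNReal.ofReal_add (by linarith) (by linarith),
          ← ENNReal.ofReal_add (by linarith) (by linarith)]
        congr 1
        ring

theorem isGδ_setOf_rankLE (hT : Continuous T) (k : ℕ) :
    IsGδ {μ : InvariantMeasure T | RankLE T (μ.1 : Measure X) k} := by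
  have heq : {μ : InvariantMeasure T | RankLE T (μ.1 : Measure X) k} =
      ⋂ N : ℕ, {μ : InvariantMeasure T | OpenTowerCover T k (1 / (N + 1)) (μ.1 : Measure X)} := by
    ext μ
    rw [Set.mem_iInter]
    exact ⟨fun h N => RankLE.openTowerCover hT μ.2 h Nat.one_div_pos_of_nat,
      fun h => RankLE.of_openTowerCover hT μ.2 h⟩
  rw [heq]
  exact IsGδ.iInter_of_isOpen fun N =>
    (isOpen_setOf_openTowerCover hT k _).preimage continuous_subtype_val

end OpenTowers

end SystemRank

theorem theorem4p1 {X : Type*} [MetricSpace X] [CompactSpace X] [MeasurableSpace X] [BorelSpace X]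
    (T : X → X) (hT : Continuous T) :
    SystemRank.IsYoungLU (fun μ : SystemRank.InvariantMeasure T =>
      (((SystemRank.rank T (μ.1 : Measure X) : ℕ∞) : ENNReal) : EReal)) := by
  refine SystemRank.isYoungLU_of_isGδ_sublevel
    (fun μ : SystemRank.InvariantMeasure T => SystemRank.rank T (μ.1 : Measure X)) fun k => ?_
  have heq : {μ : SystemRank.InvariantMeasure T | SystemRank.rank T (μ.1 : Measure X) ≤ k} =
      ⋃ j ∈ Set.Iic k, {μ : SystemRank.InvariantMeasure T |
        SystemRank.RankLE T (μ.1 : Measure X) j} := by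
    ext μ
    simp [SystemRank.rank_le_coe_iff]
  rw [heq]
  exact IsGδ.biUnion (Set.finite_Iic k) fun j _ => SystemRank.isGδ_setOf_rankLE hT j
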